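/- Let $\alpha,\beta\ge-\tfrac12$, let $w_0(x)=(1-x)^{\alpha}(1+x)^{\beta}$ on $(-1,1)$, let $p_n$ ($n\ge 0$) be the polynomial of degree $n$ with positive leading coefficient in the orthonormal system of $L^2((-1,1),w_0\,dx)$ (the orthonormal Jacobi polynomials), and let $T[y]=(1-x^2)y''+(\beta-\alpha-(\alpha+\beta+2)x)y'$. Let $$T=BA+\tilde\lambda,\qquad A[y]=b(y'-wy),\qquad B[y]=\hat b(y'-\hat wy),$$ be a factorization with $\tilde\lambda\in\mathbb R$ and real rational functions $b,w,\hat b,\hat w$, such that $b$ and $bw$ are polynomials, $\deg b\ge\deg(bw)+1$ (with $\deg 0=-\infty$), $b$ has no zero in $(-1,1)$, and $(1-x^2)w_0/b^2$ is integrable on $(-1,1)$. Put $W=c_0(1-x^2)w_0/b^2$, where $c_0$ is such that $\int_{-1}^1W\,dx=1$. The exceptional Jacobi polynomials obtained from this Darboux transformation are $\hat P_n=\frac1{\sigma_n}A[p_n]$, where $\sigma_n=\left(\int_{-1}^1(A[p_n])^2\,W\,dx\right)^{1/2}$ (and $\hat P_n=0$ if $A[p_n]=0$). Let $$K_n=\mathbb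 C\setminus\{z\in\mathbb C:\lim_{k\to\infty}\hat P_n^{k}(z)=\infty\}$$ be the filled Julia set of $\hat P_n$, where $\hat P_n^{k}$ is the $k$-fold composition, and let $D(0,R)=\{z\in\mathbb C:|z|<R\}$. Then: (a) there exist $R>1$ and $N\in\mathbb N$ such that for all $n>N$ $$K_n\subset\hat P_n^{-1}\left(\overline{D(0,R)}\right)\subset D(0,R);$$ (b) there is an $\tilde R$ such that $K_n\subset D(0,\tilde R)$ for all $n\ge 0$ with $\deg\hat P_n\ge 2$. -/

import Mathlib

open Polynomial MeasureTheory Set Filter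

noncomputable section

namespace ExceptionalJacobi

/-- The Jacobi weight `(1 - x)^α (1 + x)^β` (used on `(-1, 1)` only). -/
def jacobiWeight (α β x : ℝ) : ℝ := (1 - x) ^ α * (1 + x) ^ β

/-- The inner product of two real polynomials in `L²((-1, 1), (1 - x)^α (1 + x)^β dx)`. -/
def jacobiInner (α β : ℝ) (f g : ℝ[X]) : ℝ :=
  ∫ x in Ioo (-1 : ℝ) 1, f.eval x * g.eval x * jacobiWeight α β x

/-- The monic orthogonal polynomials of the Jacobi weight: Gram-Schmidt
orthogonalization of `1, X, X², …`. -/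
def monicJacobi (α β : ℝ) (n : ℕ) : ℝ[X] :=
  X ^ n - ∑ k : Fin n,
    C (jacobiInner α β (X ^ n) (monicJacobi α β k) /
      jacobiInner α β (monicJacobi α β k) (monicJacobi α β k)) * monicJacobi α β k
termination_by n
decreasing_by all_goals exact k.isLt

/-- The classical orthonormal Jacobi polynomial of degree `n` (with positive leading
coefficient). -/
def jacobiPoly (α β : ℝ) (n : ℕ) : ℝ[X] :=
  C (1 / √(jacobiInner α β (monicJacobi α β n) (monicJacobi α β n))) * monicJacobi α β n

/-- The classical Jacobi differential operator
`T[y] = (1 - x²) y'' + (β - α - (α + β + 2) x) y'`. -/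
def jacobiOp (α β : ℝ) (y : ℝ[X]) : ℝ[X] :=
  (1 - X ^ 2) * derivative (derivative y) + (C (β - α) - C (α + β + 2) * X) * derivative y

/-- The first order operator `A[y] = b (y' - w y)`, for polynomials `b` and `bw = b w`. -/
def opA (b bw y : ℝ[X]) : ℝ[X] := b * derivative y - bw * y

/-- The first order operator `B[u] = b̂ (u' - ŵ u)` with rational coefficients,
on polynomials `u`. -/
def opB (bhat what : RatFunc ℝ) (u : ℝ[X]) : RatFunc ℝ :=
  bhat * (algebraMap ℝ[X] (RatFunc ℝ) (derivative u) - what * algebraMap ℝ[X] (RatFunc ℝ) u)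

/-- The data of one Darboux transformation of the Jacobi operator `T`: a factorization
`T = B A + lam` into first order operators with rational coefficients
`A[y] = b (y' - w y)`, `B[y] = b̂ (y' - ŵ y)`, such that `b` and `b w` are polynomials,
`deg b ≥ deg (b w) + 1`, `b` has no zero in `(-1, 1)`, and the weight
`(1 - x²) (1 - x)^α (1 + x)^β / b²` is integrable. The operator identity is an identity
of differential operators, and is stated on all polynomials `y`. -/
structure DarbouxTransform (α β : ℝ) where
  /-- the polynomial `b` -/
  b : ℝ[X]
  /-- the rational function `w` -/
  w : RatFunc ℝ
  /-- the product `b w`, as a polynomial -/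
  bw : ℝ[X]
  /-- the rational function `b̂` -/
  bhat : RatFunc ℝ
  /-- the rational function `ŵ` -/
  what : RatFunc ℝ
  /-- the constant in the factorization -/
  lam : ℝ
  bw_eq : algebraMap ℝ[X] (RatFunc ℝ) bw = algebraMap ℝ[X] (RatFunc ℝ) b * w
  factorization : ∀ y : ℝ[X], algebraMap ℝ[X] (RatFunc ℝ) (jacobiOp α β y) =
    opB bhat what (opA b bw y) + algebraMap ℝ[X] (RatFunc ℝ) (C lam * y)
  degree_lt : bw.degree < b.degree
  b_ne_zero : ∀ x ∈ Ioo (-1 : ℝ) 1, b.eval x ≠ 0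
  integrable : IntegrableOn
    (fun x : ℝ => (1 - x ^ 2) * jacobiWeight α β x / b.eval x ^ 2) (Ioo (-1) 1)

namespace DarbouxTransform

variable {α β : ℝ}

/-- The constant `c₀` that makes `W` a probability density on `(-1, 1)`. -/
def c₀ (D : DarbouxTransform α β) : ℝ :=
  1 / ∫ x in Ioo (-1 : ℝ) 1, (1 - x ^ 2) * jacobiWeight α β x / D.b.eval x ^ 2

/-- The exceptional weight `W = c₀ (1 - x²) (1 - x)^α (1 + x)^β / b²`. -/
def W (D : DarbouxTransform α β) (x : ℝ) : ℝ :=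
  D.c₀ * ((1 - x ^ 2) * jacobiWeight α β x / D.b.eval x ^ 2)

/-- The normalization constant `σₙ`: the norm of `A pₙ` in `L²((-1, 1), W dx)`. -/
def σ (D : DarbouxTransform α β) (n : ℕ) : ℝ :=
  √(∫ x in Ioo (-1 : ℝ) 1, (opA D.b D.bw (jacobiPoly α β n)).eval x ^ 2 * D.W x)

/-- The exceptional Jacobi polynomial `P̂ₙ = A pₙ / σₙ`. -/
def excPoly (D : DarbouxTransform α β) (n : ℕ) : ℝ[X] :=
  C (1 / D.σ n) * opA D.b D.bw (jacobiPoly α β n)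

/-- `P̂ₙ` as a map of the complex plane. -/
def excMap (D : DarbouxTransform α β) (n : ℕ) (z : ℂ) : ℂ := aeval z (D.excPoly n)

end DarbouxTransform

/-- The basin of attraction of infinity of a self-map of the complex plane. -/
def basinOfInfinity (f : ℂ → ℂ) : Set ℂ :=
  {z | Tendsto (fun k : ℕ => ‖f^[k] z‖) atTop atTop}

/-- The filled Julia set: the complement of the basin of attraction of infinity. -/
def filledJulia (f : ℂ → ℂ) : Set ℂ := (basinOfInfinity f)ᶜ

end ExceptionalJacobi

end

open Polynomial MeasureTheory Set Filter

/-! If a map at least doubles `‖z‖` wherever `R ≤ ‖z‖`, that region lies in the basin of infinity,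
and both inclusions of (a) follow. So one needs such an `R` that serves all large `n`.

The zeros of the monic Jacobi polynomial `M` of degree `n` lie in the closed unit disc, which gives
two bounds. Outside the disc, `(‖z‖ - 1) ^ n ≤ ‖M z‖`, and the logarithmic derivative gives `n / 2 *
‖M z‖ ≤ ‖z‖ * ‖M' z‖`. As `deg bw < deg b`, the term `b M'` dominates `bw M` for large `n`, so `‖z‖
* ‖A[M] z‖` is at least a constant times `n (‖z‖ - 1) ^ n` (`exists_le_norm_aeval_opA`). On `[-1,
1]`, `M` and `M'` are at most `2 ^ n` and `n 2 ^ n`; since `W` is a probability density, the norm of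
`A[M]` is `O(n 2 ^ n)` (`exists_normW_opA_le`). In the quotient the factor `n` cancels and `((‖z‖ -
1) / 2) ^ n / ‖z‖` remains, which beats `2 ‖z‖`.

For (b), each of the finitely many remaining `n` has its own escape radius. -/

namespace ExceptionalJacobi

/-! ### Escape to infinity -/

section Dynamics

/-- A map that doubles norms outside a disc escapes to infinity there. -/
lemma mem_basinOfInfinity {f : ℂ → ℂ} {R : ℝ} (hR : 0 < R)
    (hf : ∀ z, R ≤ ‖z‖ → 2 * ‖z‖ ≤ ‖f z‖) {z : ℂ} (hz : R ≤ ‖z‖) :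
    z ∈ basinOfInfinity f := by
  have key : ∀ k : ℕ, 2 ^ k * R ≤ ‖f^[k] z‖ := by
    intro k
    induction k with
    | zero => simpa using hz
    | succ k ih =>
      rw [Function.iterate_succ_apply', pow_succ]
      have h1 : R ≤ 2 ^ k * R := le_mul_of_one_le_left hR.le (one_le_pow₀ one_le_two)
      have := hf _ (h1.trans ih)
      linarith
  exact tendsto_atTop_mono key
    ((tendsto_pow_atTop_atTop_of_one_lt one_lt_two).atTop_mul_const hR)

lemma mem_basinOfInfinity_of_apply {f : ℂ → ℂ} {z : ℂ} (hz : f z ∈ basinOfInfinity f) :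
    z ∈ basinOfInfinity f := by
  have h : Tendsto (fun k : ℕ => ‖f^[k] (f z)‖) atTop atTop := hz
  exact (tendsto_add_atTop_iff_nat 1).1 h

lemma filledJulia_subset {f : ℂ → ℂ} {R : ℝ} (hR : 0 < R)
    (hf : ∀ z, R ≤ ‖z‖ → 2 * ‖z‖ ≤ ‖f z‖) :
    filledJulia f ⊆ f ⁻¹' Metric.closedBall 0 R ∧
      f ⁻¹' Metric.closedBall 0 R ⊆ Metric.ball 0 R := by
  constructor
  · intro z hz
    by_contra h
    simp only [mem_preimage, mem_closedBall_zero_iff, not_le] at h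
    exact hz (mem_basinOfInfinity_of_apply (mem_basinOfInfinity hR hf h.le))
  · intro z hz
    simp only [mem_preimage, mem_closedBall_zero_iff, mem_ball_zero_iff] at hz ⊢
    by_contra! h
    linarith [hf z h]

end Dynamics

/-! ### Growth of a fixed polynomial -/

section Growth

lemma exists_norm_aeval_le (q : ℝ[X]) {d : ℕ} (hq : q.natDegree ≤ d) :
    ∃ S : ℝ, 0 ≤ S ∧ ∀ z : ℂ, 1 ≤ ‖z‖ → ‖aeval z q‖ ≤ S * ‖z‖ ^ d := by
  refine ⟨∑ i ∈ Finset.range (q.natDegree + 1), ‖q.coeff i‖,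
    Finset.sum_nonneg fun _ _ => norm_nonneg _, fun z hz => ?_⟩
  rw [aeval_eq_sum_range, Finset.sum_mul]
  refine (norm_sum_le _ _).trans (Finset.sum_le_sum fun i hi => ?_)
  rw [norm_smul, norm_pow]
  have := Finset.mem_range.1 hi
  gcongr
  omega

lemma exists_norm_mul_aeval_le (q : ℝ[X]) {d : ℕ} (hq : q.degree < d) :
    ∃ S : ℝ, 0 ≤ S ∧ ∀ z : ℂ, 1 ≤ ‖z‖ → ‖z‖ * ‖aeval z q‖ ≤ S * ‖z‖ ^ d := by
  have h : (X * q).natDegree ≤ d := by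
    rcases eq_or_ne q 0 with rfl | h0
    · simp
    · rw [natDegree_X_mul h0]
      exact (natDegree_lt_iff_degree_lt h0).2 hq
  obtain ⟨S, hS, hb⟩ := exists_norm_aeval_le _ h
  exact ⟨S, hS, fun z hz => by simpa using hb z hz⟩

lemma exists_le_norm_aeval {p : ℝ[X]} (hp : p ≠ 0) :
    ∃ l : ℝ, 0 < l ∧ ∃ R : ℝ, 1 ≤ R ∧
      ∀ z : ℂ, R ≤ ‖z‖ → l * ‖z‖ ^ p.natDegree ≤ ‖aeval z p‖ := by
  have hd : p.eraseLead.degree < (p.natDegree : ℕ) := by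
    rw [← degree_eq_natDegree hp]
    exact degree_eraseLead_lt hp
  obtain ⟨S, hS, hb⟩ := exists_norm_mul_aeval_le _ hd
  have hl : 0 < ‖p.leadingCoeff‖ := norm_pos_iff.2 (leadingCoeff_ne_zero.2 hp)
  set L := ‖p.leadingCoeff‖
  -- Beyond `2 * S / L` the lower order terms are at most half of the leading term.
  refine ⟨L / 2, half_pos hl, max 1 (2 * S / L), le_max_left _ _, fun z hz => ?_⟩
  have hz1 : 1 ≤ ‖z‖ := (le_max_left _ _).trans hz
  have hz2 : S ≤ L / 2 * ‖z‖ := by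
    have := (le_max_right _ _).trans hz
    rw [div_le_iff₀ hl] at this
    linarith
  have hsplit : aeval z p = aeval z p.eraseLead + (p.leadingCoeff : ℂ) * z ^ p.natDegree := by
    conv_lhs => rw [← p.eraseLead_add_monomial_natDegree_leadingCoeff]
    rw [map_add, aeval_monomial, Complex.coe_algebraMap]
  have h1 : L * ‖z‖ ^ p.natDegree - ‖aeval z p.eraseLead‖ ≤ ‖aeval z p‖ := by
    rw [hsplit, add_comm]
    refine le_trans (le_of_eq ?_) (norm_sub_le_norm_add _ _)
    rw [norm_mul, norm_pow, Complex.norm_real]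
  have h2 : ‖aeval z p.eraseLead‖ ≤ L / 2 * ‖z‖ ^ p.natDegree := by
    refine le_of_mul_le_mul_left ((hb z hz1).trans ?_) (zero_lt_one.trans_le hz1)
    calc S * ‖z‖ ^ p.natDegree ≤ L / 2 * ‖z‖ * ‖z‖ ^ p.natDegree := by gcongr
      _ = _ := by ring
  linarith

lemma exists_two_mul_norm_le {p : ℝ[X]} (hp : 2 ≤ p.natDegree) :
    ∃ R : ℝ, 0 < R ∧ ∀ z : ℂ, R ≤ ‖z‖ → 2 * ‖z‖ ≤ ‖aeval z p‖ := by
  have h0 : p ≠ 0 := by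
    rintro rfl
    simp at hp
  obtain ⟨l, hl, R, hR, h⟩ := exists_le_norm_aeval h0
  refine ⟨max R (2 / l), by positivity, fun z hz => ?_⟩
  have hz1 : R ≤ ‖z‖ := (le_max_left _ _).trans hz
  have hz2 := (le_max_right _ _).trans hz
  rw [div_le_iff₀ hl] at hz2
  calc 2 * ‖z‖ ≤ ‖z‖ * l * ‖z‖ := by gcongr
    _ = l * ‖z‖ ^ 2 := by ring
    _ ≤ l * ‖z‖ ^ p.natDegree := by
      gcongr
      exact hR.trans hz1
    _ ≤ _ := h z hz1

end Growth

/-! ### Polynomials with all zeros in the unit disc -/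

section RootsInDisc

/-- After clearing `|z - a|²`, the inequality reduces to `|a|² ≤ |z|²`. -/
lemma half_le_re_div_sub {z a : ℂ} (ha : ‖a‖ ≤ 1) (hz : 1 < ‖z‖) :
    1 / 2 ≤ (z / (z - a)).re := by
  have hne : z - a ≠ 0 := by
    intro h
    rw [sub_eq_zero.1 h] at hz
    linarith
  have hpos : 0 < Complex.normSq (z - a) := Complex.normSq_pos.2 hne
  have hza : Complex.normSq a ≤ Complex.normSq z := by
    rw [Complex.normSq_eq_norm_sq, Complex.normSq_eq_norm_sq]
    gcongr
    linarith
  rw [Complex.div_re, ← add_div, div_le_div_iff₀ two_pos hpos]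
  simp only [Complex.normSq_apply, Complex.sub_re, Complex.sub_im] at hza ⊢
  nlinarith

/-- Bounds for a monic polynomial with all zeros in the closed unit disc and for its
derivative, outside that disc. -/
lemma bounds_outside_disc (s : Multiset ℂ) (hs : ∀ a ∈ s, ‖a‖ ≤ 1) {z : ℂ} (hz : 1 < ‖z‖) :
    (‖z‖ - 1) ^ s.card ≤ ‖(s.map fun a => X - C a).prod.eval z‖ ∧
    (s.card : ℝ) / 2 ≤ (z * (derivative (s.map fun a => X - C a).prod).eval z /
      (s.map fun a => X - C a).prod.eval z).re := by
  induction s using Multiset.induction with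
  | empty => simp
  | cons a s ih =>
    obtain ⟨ih1, ih2⟩ := ih fun b hb => hs b (Multiset.mem_cons_of_mem hb)
    have ha := hs a (Multiset.mem_cons_self a s)
    set p := (s.map fun a => X - C a).prod
    have hp : p.eval z ≠ 0 :=
      norm_pos_iff.1 ((pow_pos (sub_pos.2 hz) _).trans_le ih1)
    have hne : z - a ≠ 0 := by
      intro h
      rw [sub_eq_zero.1 h] at hz
      linarith
    simp only [Multiset.map_cons, Multiset.prod_cons, Multiset.card_cons]
    constructor
    · rw [eval_mul, norm_mul, pow_succ']
      refine mul_le_mul ?_ ih1 (pow_nonneg (by linarith) _) (norm_nonneg _)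
      simp only [eval_sub, eval_X, eval_C]
      linarith [norm_sub_norm_le z a]
    -- Logarithmic derivatives add up, so each zero contributes at least `1 / 2`.
    · have : z * (derivative ((X - C a) * p)).eval z / ((X - C a) * p).eval z =
          z / (z - a) + z * (derivative p).eval z / p.eval z := by
        simp only [derivative_mul, derivative_sub, derivative_X, derivative_C, eval_add,
          eval_mul, eval_sub, eval_X, eval_C, eval_one, eval_zero]
        field_simp
        ring
      rw [this, Complex.add_re]
      push_cast
      linarith [half_le_re_div_sub ha hz]

lemma bounds_in_disc (s : Multiset ℂ) (hs : ∀ a ∈ s, ‖a‖ ≤ 1) {z : ℂ} (hz : ‖z‖ ≤ 1) :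
    ‖(s.map fun a => X - C a).prod.eval z‖ ≤ 2 ^ s.card ∧
    ‖(derivative (s.map fun a => X - C a).prod).eval z‖ ≤ s.card * 2 ^ s.card := by
  induction s using Multiset.induction with
  | empty => simp
  | cons a s ih =>
    obtain ⟨ih1, ih2⟩ := ih fun b hb => hs b (Multiset.mem_cons_of_mem hb)
    have ha := hs a (Multiset.mem_cons_self a s)
    set p := (s.map fun a => X - C a).prod
    have hza : ‖z - a‖ ≤ 2 := (norm_sub_le z a).trans (by linarith)
    simp only [Multiset.map_cons, Multiset.prod_cons, Multiset.card_cons]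
    constructor
    · rw [eval_mul, norm_mul, pow_succ']
      gcongr
      simpa using hza
    · simp only [derivative_mul, derivative_sub, derivative_X, derivative_C, eval_add,
          eval_mul, eval_sub, eval_X, eval_C, sub_zero, one_mul]
      have h1 : ‖(z - a) * (derivative p).eval z‖ ≤ 2 * (s.card * 2 ^ s.card) := by
        rw [norm_mul]
        gcongr
      have h2 := norm_add_le (p.eval z) ((z - a) * (derivative p).eval z)
      have h3 : (0 : ℝ) < 2 ^ s.card := by positivity
      push_cast
      rw [pow_succ]
      nlinarith

/-- The consequences of `bounds_outside_disc` and `bounds_in_disc` for a real polynomial. -/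
lemma bounds_of_monic {p : ℝ[X]} (hp : p.Monic)
    (hroots : ∀ z : ℂ, aeval z p = 0 → ‖z‖ ≤ 1) :
    (∀ z : ℂ, 1 < ‖z‖ → (‖z‖ - 1) ^ p.natDegree ≤ ‖aeval z p‖ ∧
      p.natDegree / 2 * ‖aeval z p‖ ≤ ‖z‖ * ‖aeval z (derivative p)‖) ∧
    ∀ x : ℝ, |x| ≤ 1 → |p.eval x| ≤ 2 ^ p.natDegree ∧
      |(derivative p).eval x| ≤ p.natDegree * 2 ^ p.natDegree := by
  set q := p.map (algebraMap ℝ ℂ) with hq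
  have hqm : q.Monic := hp.map _
  have hsplit : (q.roots.map fun a => X - C a).prod = q :=
    ((IsAlgClosed.splits q).eq_prod_roots_of_monic hqm).symm
  have hcard : q.roots.card = p.natDegree := by
    rw [← (IsAlgClosed.splits q).natDegree_eq_card_roots, hq, natDegree_map]
  have hev : ∀ z, q.eval z = aeval z p := fun z => by rw [hq, eval_map_algebraMap]
  have hdev : ∀ z, (derivative q).eval z = aeval z (derivative p) := fun z => by
    rw [hq, derivative_map, eval_map_algebraMap]
  have hs : ∀ a ∈ q.roots, ‖a‖ ≤ 1 := fun a ha => by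
    refine hroots a ?_
    rw [← hev]
    exact (mem_roots'.1 ha).2
  constructor
  · intro z hz
    have h := bounds_outside_disc _ hs hz
    rw [hsplit, hcard, hev, hdev] at h
    refine ⟨h.1, ?_⟩
    have hpos : 0 < ‖aeval z p‖ := (pow_pos (sub_pos.2 hz) _).trans_le h.1
    have h2 := h.2.trans (Complex.re_le_norm _)
    rwa [norm_div, norm_mul, le_div_iff₀ hpos] at h2
  · intro x hx
    have h := bounds_in_disc _ hs (z := (x : ℂ)) (by simpa using hx)
    rw [hsplit, hcard, hev, hdev] at h
    have e : ∀ r : ℝ[X], ‖aeval (x : ℂ) r‖ = |r.eval x| := fun r => by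
      have : aeval (x : ℂ) r = ((r.eval x : ℝ) : ℂ) := by
        rw [← Complex.coe_algebraMap, aeval_algebraMap_apply, coe_aeval_eq_eval]
      rw [this, Complex.norm_real, Real.norm_eq_abs]
    rwa [e, e] at h

end RootsInDisc

/-! ### Integrability and positivity of weights -/

section Weights

lemma integrableOn_eval_mul (p : ℝ[X]) {v : ℝ → ℝ} (hv : IntegrableOn v (Ioo (-1) 1)) :
    IntegrableOn (fun x => p.eval x * v x) (Ioo (-1) 1) := by
  obtain ⟨K, hK⟩ := (isCompact_Icc (a := (-1 : ℝ)) (b := 1)).exists_bound_of_continuousOn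
    p.continuous.continuousOn
  refine hv.bdd_mul p.continuous.aestronglyMeasurable (c := K) ?_
  filter_upwards [ae_restrict_mem measurableSet_Ioo] with x hx using hK x (Ioo_subset_Icc_self hx)

lemma setIntegral_sq_mul_pos {p : ℝ[X]} (hp : p ≠ 0) {v : ℝ → ℝ}
    (hv : IntegrableOn v (Ioo (-1) 1)) (hpos : ∀ x ∈ Ioo (-1 : ℝ) 1, 0 < v x) :
    0 < ∫ x in Ioo (-1 : ℝ) 1, p.eval x ^ 2 * v x := by
  have hint : IntegrableOn (fun x => p.eval x ^ 2 * v x) (Ioo (-1) 1) := by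
    exact (integrableOn_eval_mul (p ^ 2) hv).congr_fun (fun x _ => by simp) measurableSet_Ioo
  rw [setIntegral_pos_iff_support_of_nonneg_ae ?_ hint]
  · have hsub : Ioo (-1 : ℝ) 1 \ (p.roots.toFinset : Set ℝ) ⊆
        Function.support (fun x => p.eval x ^ 2 * v x) ∩ Ioo (-1) 1 := by
      rintro x ⟨hx, hxr⟩
      refine ⟨?_, hx⟩
      have : p.eval x ≠ 0 := fun h => hxr (by simp [hp, h])
      exact mul_ne_zero (pow_ne_zero _ this) (hpos x hx).ne'
    refine lt_of_lt_of_le ?_ (measure_mono hsub)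
    rw [measure_sdiff_null (p.roots.toFinset.finite_toSet.measure_zero _)]
    simp
  · filter_upwards [ae_restrict_mem measurableSet_Ioo] with x hx
    exact mul_nonneg (sq_nonneg _) (hpos x hx).le

lemma jacobiWeight_pos (α β : ℝ) {x : ℝ} (hx : x ∈ Ioo (-1 : ℝ) 1) : 0 < jacobiWeight α β x :=
  mul_pos (Real.rpow_pos_of_pos (by linarith [hx.2]) _)
    (Real.rpow_pos_of_pos (by linarith [hx.1]) _)

lemma intervalIntegrable_jacobiWeight_left (α : ℝ) {β : ℝ} (hβ : -1 < β) :
    IntervalIntegrable (jacobiWeight α β) volume (-1) 0 := by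
  have h1 : IntervalIntegrable (fun x : ℝ => (1 + x) ^ β) volume (-1) 0 := by
    have := (intervalIntegral.intervalIntegrable_rpow' hβ (a := 0) (b := 1)).comp_add_left 1
    simpa using this
  refine h1.continuousOn_mul ?_
  rw [uIcc_of_le (by norm_num)]
  refine ContinuousOn.rpow_const (by fun_prop) fun x hx => Or.inl ?_
  linarith [hx.2]

lemma integrableOn_jacobiWeight {α β : ℝ} (hα : -1 < α) (hβ : -1 < β) :
    IntegrableOn (jacobiWeight α β) (Ioo (-1) 1) := by
  have h1 := intervalIntegrable_jacobiWeight_left α hβ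
  have h2 : IntervalIntegrable (jacobiWeight α β) volume 0 1 := by
    -- The reflection `x ↦ -x` exchanges `α` and `β`.
    have := ((intervalIntegrable_jacobiWeight_left β hα).comp_sub_left 0).symm
    simp only [zero_sub, sub_zero, neg_neg] at this
    refine this.congr fun x _ => ?_
    simp only [jacobiWeight]
    rw [mul_comm]
    ring_nf
  have := (h1.trans h2)
  rw [intervalIntegrable_iff_integrableOn_Ioo_of_le (by norm_num)] at this
  exact this

end Weights

/-! ### Orthogonality and location of the zeros -/

section Orthogonality

variable {α β : ℝ}

/-- Integration of polynomials against an integrable weight on `(-1, 1)`. -/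
noncomputable def weightFunctional {v : ℝ → ℝ} (hv : IntegrableOn v (Ioo (-1) 1)) : ℝ[X] →ₗ[ℝ] ℝ where
  toFun p := ∫ x in Ioo (-1 : ℝ) 1, p.eval x * v x
  map_add' p q := by
    rw [← integral_add (integrableOn_eval_mul p hv) (integrableOn_eval_mul q hv)]
    simp [add_mul]
  map_smul' c p := by
    rw [RingHom.id_apply, smul_eq_mul, ← integral_const_mul]
    simp [mul_assoc]

lemma jacobiInner_eq (hw : IntegrableOn (jacobiWeight α β) (Ioo (-1) 1)) (f g : ℝ[X]) :
    jacobiInner α β f g = weightFunctional hw (f * g) := by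
  simp [jacobiInner, weightFunctional]

lemma degree_sum_monicJacobi_lt (n : ℕ) (c : Fin n → ℝ)
    (h : ∀ k : Fin n, (monicJacobi α β k).degree ≤ (k : ℕ)) :
    (∑ k : Fin n, C (c k) * monicJacobi α β k).degree < (n : ℕ) := by
  rw [← mem_degreeLT]
  refine Submodule.sum_mem _ fun k _ => mem_degreeLT.2 ?_
  refine lt_of_le_of_lt ?_ (Nat.cast_lt.2 k.isLt)
  rw [← smul_eq_C_mul]
  exact (degree_smul_le _ _).trans (h k)

lemma degree_monicJacobi (α β : ℝ) (n : ℕ) :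
    (monicJacobi α β n).Monic ∧ (monicJacobi α β n).degree = n := by
  induction n using Nat.strong_induction_on with
  | _ n ih =>
    have hlt := degree_sum_monicJacobi_lt (α := α) (β := β) n
      (fun k => jacobiInner α β (X ^ n) (monicJacobi α β k) /
        jacobiInner α β (monicJacobi α β k) (monicJacobi α β k))
      fun k => (ih k k.isLt).2.le
    rw [monicJacobi]
    refine ⟨(monic_X_pow n).sub_of_left (by rwa [degree_X_pow]), ?_⟩
    rw [degree_sub_eq_left_of_degree_lt (by rwa [degree_X_pow]), degree_X_pow]

lemma natDegree_monicJacobi (α β : ℝ) (n : ℕ) : (monicJacobi α β n).natDegree = n :=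
  natDegree_eq_of_degree_eq_some (degree_monicJacobi α β n).2

lemma jacobiInner_monicJacobi_of_lt (hw : IntegrableOn (jacobiWeight α β) (Ioo (-1) 1)) (n : ℕ) :
    ∀ k < n, jacobiInner α β (monicJacobi α β n) (monicJacobi α β k) = 0 := by
  induction n using Nat.strong_induction_on with
  | _ n ih =>
    intro k hk
    have hne : jacobiInner α β (monicJacobi α β k) (monicJacobi α β k) ≠ 0 := by
      have := setIntegral_sq_mul_pos (degree_monicJacobi α β k).1.ne_zero hw
        fun x hx => jacobiWeight_pos α β hx
      simp only [sq] at this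
      exact this.ne'
    have hzero : ∀ j < n, j ≠ k →
        jacobiInner α β (monicJacobi α β j) (monicJacobi α β k) = 0 := by
      intro j hj hjk
      rcases hjk.lt_or_gt with h | h
      · have := ih k hk j h
        rw [jacobiInner_eq hw] at this ⊢
        rwa [mul_comm]
      · exact ih j hj k h
    conv_lhs => rw [monicJacobi, jacobiInner_eq hw]
    rw [sub_mul, map_sub, Finset.sum_mul, map_sum, Finset.sum_eq_single ⟨k, hk⟩]
    · simp only
      rw [mul_assoc, ← smul_eq_C_mul, map_smul, ← jacobiInner_eq, ← jacobiInner_eq, smul_eq_mul,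
        div_mul_cancel₀ _ hne, sub_self]
    · intro j _ hjk
      rw [mul_assoc, ← smul_eq_C_mul, map_smul, ← jacobiInner_eq hw (monicJacobi α β j),
        hzero j j.isLt (fun h => hjk (Fin.ext h)), smul_zero]
    · simp

lemma jacobiInner_monicJacobi_of_degree_lt
    (hw : IntegrableOn (jacobiWeight α β) (Ioo (-1) 1)) (n : ℕ) (m : ℕ) :
    m ≤ n → ∀ q : ℝ[X], q.degree < m → jacobiInner α β (monicJacobi α β n) q = 0 := by
  induction m with
  | zero =>
    intro _ q hq
    have : q = 0 := by simpa using hq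
    simp [this, jacobiInner]
  | succ m ih =>
    intro hm q hq
    set r := q - C (q.coeff m) * monicJacobi α β m with hr
    have hrdeg : r.degree < m := by
      rw [degree_lt_iff_coeff_zero]
      intro j hj
      rcases hj.eq_or_lt with rfl | hj
      · have : (monicJacobi α β m).coeff m = 1 := by
          have := (degree_monicJacobi α β m).1.coeff_natDegree
          rwa [natDegree_monicJacobi] at this
        simp [hr, this]
      · have h1 : q.coeff j = 0 := (degree_lt_iff_coeff_zero _ _).1 hq j hj
        have h2 : (monicJacobi α β m).coeff j = 0 :=
          coeff_eq_zero_of_natDegree_lt (by rwa [natDegree_monicJacobi])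
        simp [hr, h1, h2]
    have h1 := ih (by omega) r hrdeg
    have h2 := jacobiInner_monicJacobi_of_lt hw n m (by omega)
    have hq' : q = r + q.coeff m • monicJacobi α β m := by
      rw [hr, smul_eq_C_mul]
      ring
    rw [jacobiInner_eq hw] at h1 h2 ⊢
    rw [hq', mul_add, map_add, h1, mul_smul_comm, map_smul, h2]
    simp

/-- A factor of positive degree of an orthogonal polynomial is not positive on `(-1, 1)`. -/
lemma monicJacobi_ne_mul (hw : IntegrableOn (jacobiWeight α β) (Ioo (-1) 1)) {n : ℕ}
    {q r : ℝ[X]} (hr : 0 < r.degree) (hpos : ∀ x ∈ Ioo (-1 : ℝ) 1, 0 < r.eval x) :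
    monicJacobi α β n ≠ r * q := by
  intro h
  have hM := (degree_monicJacobi α β n).1.ne_zero
  have hq : q ≠ 0 := by
    rintro rfl
    exact hM (by rw [h, mul_zero])
  have hdeg : q.degree < n := by
    rw [← (degree_monicJacobi α β n).2, h, degree_mul, degree_eq_natDegree hq]
    have hr' := natDegree_pos_iff_degree_pos.2 hr
    rw [degree_eq_natDegree (ne_zero_of_degree_gt hr)]
    norm_cast
    omega
  have h0 := jacobiInner_monicJacobi_of_degree_lt hw n n le_rfl q hdeg
  -- The inner product with `q` is the integral of `q ^ 2` against the positive weight `r *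
  -- jacobiWeight`.
  have h1 := setIntegral_sq_mul_pos hq (integrableOn_eval_mul r hw)
    fun x hx => mul_pos (hpos x hx) (jacobiWeight_pos α β hx)
  refine h1.ne' (Eq.trans ?_ h0)
  simp only [jacobiInner, h, eval_mul]
  congr 1
  ext x
  ring

/-- A real zero outside `[-1, 1]`, or a conjugate pair of non-real zeros, would give a real factor
positive on `(-1, 1)`, against `monicJacobi_ne_mul`. -/
lemma norm_le_one_of_aeval_monicJacobi (hw : IntegrableOn (jacobiWeight α β) (Ioo (-1) 1))
    {n : ℕ} {z : ℂ} (hz : aeval z (monicJacobi α β n) = 0) : ‖z‖ ≤ 1 := by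
  by_cases him : z.im = 0
  · obtain ⟨a, rfl⟩ : ∃ a : ℝ, z = a := ⟨z.re, Complex.ext rfl (by simpa using him)⟩
    have ha : (monicJacobi α β n).IsRoot a := by
      rw [← Complex.coe_algebraMap, aeval_algebraMap_apply, coe_aeval_eq_eval] at hz
      simpa using hz
    obtain ⟨q, hq⟩ := dvd_iff_isRoot.2 ha
    rw [Complex.norm_real, Real.norm_eq_abs, abs_le]
    constructor <;> by_contra! hlt
    · refine monicJacobi_ne_mul hw (r := X - C a) (by simp) (fun x hx => ?_) hq
      simp only [eval_sub, eval_X, eval_C]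
      linarith [hx.1]
    · refine monicJacobi_ne_mul hw (n := n) (r := C a - X) (q := -q) ?_ (fun x hx => ?_) ?_
      · rw [← degree_neg, neg_sub]
        simp
      · simp only [eval_sub, eval_X, eval_C]
        linarith [hx.2]
      · rw [hq]
        ring
  · obtain ⟨q, hq⟩ := quadratic_dvd_of_aeval_eq_zero_im_ne_zero _ hz him
    refine absurd hq (monicJacobi_ne_mul hw ?_ fun x _ => ?_)
    · have : (X ^ 2 - C (2 * z.re) * X + C (‖z‖ ^ 2) : ℝ[X]).degree = 2 := by
        compute_degree!
      rw [this]
      exact two_pos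
    · have h1 : ‖z‖ ^ 2 = z.re ^ 2 + z.im ^ 2 := by
        rw [← Complex.normSq_eq_norm_sq, Complex.normSq_apply]
        ring
      have h2 : 0 < z.im ^ 2 := by positivity
      simp only [eval_add, eval_sub, eval_mul, eval_pow, eval_X, eval_C, h1]
      nlinarith [sq_nonneg (x - z.re)]

end Orthogonality

/-! ### Estimates for the exceptional polynomials -/

namespace DarbouxTransform

variable {α β : ℝ} (D : DarbouxTransform α β)

lemma polynomial_b_ne_zero : D.b ≠ 0 := by
  intro h
  exact D.b_ne_zero 0 (by norm_num) (by simp [h])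

lemma unnormalized_weight_pos {x : ℝ} (hx : x ∈ Ioo (-1 : ℝ) 1) :
    0 < (1 - x ^ 2) * jacobiWeight α β x / D.b.eval x ^ 2 := by
  have h1 : 0 < 1 - x ^ 2 := by nlinarith [hx.1, hx.2]
  have h2 := jacobiWeight_pos α β hx
  have h3 := D.b_ne_zero x hx
  positivity

lemma c₀_pos : 0 < D.c₀ := by
  have := setIntegral_sq_mul_pos one_ne_zero D.integrable fun x hx => D.unnormalized_weight_pos hx
  simp only [eval_one, one_pow, one_mul] at this
  exact one_div_pos.2 this

lemma W_pos {x : ℝ} (hx : x ∈ Ioo (-1 : ℝ) 1) : 0 < D.W x :=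
  mul_pos D.c₀_pos (D.unnormalized_weight_pos hx)

lemma integrableOn_W : IntegrableOn D.W (Ioo (-1) 1) := D.integrable.const_mul _

lemma integral_W : ∫ x in Ioo (-1 : ℝ) 1, D.W x = 1 := by
  have h := D.c₀_pos.ne'
  simp only [W]
  rw [integral_const_mul]
  rw [c₀] at h ⊢
  -- A zero integral would give `c₀ = 1 / 0 = 0`.
  exact one_div_mul_cancel (fun h0 => h (by rw [h0, div_zero]))

/-- The norm of a polynomial in `L²((-1, 1), W dx)`. -/
noncomputable def normW (f : ℝ[X]) : ℝ := √(∫ x in Ioo (-1 : ℝ) 1, f.eval x ^ 2 * D.W x)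

lemma normW_pos {f : ℝ[X]} (hf : f ≠ 0) : 0 < D.normW f :=
  Real.sqrt_pos.2 (setIntegral_sq_mul_pos hf D.integrableOn_W fun _ hx => D.W_pos hx)

lemma normW_le {f : ℝ[X]} {K : ℝ} (hK : 0 ≤ K) (hf : ∀ x : ℝ, |x| ≤ 1 → |f.eval x| ≤ K) :
    D.normW f ≤ K := by
  refine Real.sqrt_le_iff.2 ⟨hK, ?_⟩
  calc ∫ x in Ioo (-1 : ℝ) 1, f.eval x ^ 2 * D.W x
      ≤ ∫ x in Ioo (-1 : ℝ) 1, K ^ 2 * D.W x := by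
        refine setIntegral_mono_on ?_ (D.integrableOn_W.const_mul _) measurableSet_Ioo
          fun x hx => ?_
        · exact (integrableOn_eval_mul (f ^ 2) D.integrableOn_W).congr_fun (fun x _ => by simp)
            measurableSet_Ioo
        · refine mul_le_mul_of_nonneg_right ?_ (D.W_pos hx).le
          exact sq_le_sq' (abs_le.1 (hf x (abs_le.2 ⟨hx.1.le, hx.2.le⟩))).1
            (abs_le.1 (hf x (abs_le.2 ⟨hx.1.le, hx.2.le⟩))).2
    _ = K ^ 2 := by rw [integral_const_mul, D.integral_W, mul_one]

lemma normW_C_mul {c : ℝ} (hc : 0 ≤ c) (f : ℝ[X]) : D.normW (C c * f) = c * D.normW f := by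
  simp only [normW, eval_mul, eval_C, mul_pow, mul_assoc]
  rw [integral_const_mul, Real.sqrt_mul (sq_nonneg c), Real.sqrt_sq hc]

/-- The exceptional polynomials do not depend on the normalization of the Jacobi polynomials. -/
lemma excPoly_eq (hw : IntegrableOn (jacobiWeight α β) (Ioo (-1) 1)) (n : ℕ) :
    D.excPoly n = C (1 / D.normW (opA D.b D.bw (monicJacobi α β n))) *
      opA D.b D.bw (monicJacobi α β n) := by
  have hγ : 0 < 1 / √(jacobiInner α β (monicJacobi α β n) (monicJacobi α β n)) := by
    have := setIntegral_sq_mul_pos (degree_monicJacobi α β n).1.ne_zero hw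
      fun x hx => jacobiWeight_pos α β hx
    simp only [sq] at this
    exact one_div_pos.2 (Real.sqrt_pos.2 this)
  set γ := 1 / √(jacobiInner α β (monicJacobi α β n) (monicJacobi α β n)) with hγdef
  have hA : opA D.b D.bw (jacobiPoly α β n) = C γ * opA D.b D.bw (monicJacobi α β n) := by
    simp only [opA, jacobiPoly, ← hγdef, derivative_C_mul]
    ring
  have hσ : D.σ n = γ * D.normW (opA D.b D.bw (monicJacobi α β n)) := by
    rw [← D.normW_C_mul hγ.le, ← hA]
    rfl
  rw [excPoly, hA, hσ, ← mul_assoc, ← C_mul]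
  congr 2
  field_simp

lemma norm_excMap (hw : IntegrableOn (jacobiWeight α β) (Ioo (-1) 1)) (n : ℕ) (z : ℂ) :
    ‖D.excMap n z‖ = ‖aeval z (opA D.b D.bw (monicJacobi α β n))‖ /
      D.normW (opA D.b D.bw (monicJacobi α β n)) := by
  rw [excMap, D.excPoly_eq hw, map_mul, aeval_C, norm_mul, Complex.coe_algebraMap,
    Complex.norm_real, Real.norm_of_nonneg (by unfold normW; positivity)]
  ring

/-- Outside a fixed disc, `A[y]` is at least of the order of `n y / z` for the monic Jacobi
polynomial `y` of large degree `n`. -/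
lemma exists_le_norm_aeval_opA (hw : IntegrableOn (jacobiWeight α β) (Ioo (-1) 1)) :
    ∃ c > 0, ∃ R : ℝ, 1 < R ∧ ∃ N : ℕ, ∀ n ≥ N, ∀ z : ℂ, R ≤ ‖z‖ →
      c * n * (‖z‖ - 1) ^ n ≤ ‖z‖ * ‖aeval z (opA D.b D.bw (monicJacobi α β n))‖ := by
  obtain ⟨l, hl, R, hR, hb⟩ := exists_le_norm_aeval D.polynomial_b_ne_zero
  obtain ⟨S, hS, hbw⟩ := exists_norm_mul_aeval_le D.bw (d := D.b.natDegree)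
    (by rw [← degree_eq_natDegree D.polynomial_b_ne_zero]; exact D.degree_lt)
  -- From this `N` on, the `bw` term is at most half of the lower bound `l * n / 2` for the `b`
  -- term, leaving `l / 4 * n`.
  obtain ⟨N, hN⟩ := exists_nat_ge (4 * S / l)
  refine ⟨l / 4, by positivity, R + 1, by linarith, N, fun n hn z hz => ?_⟩
  have hz1 : 1 < ‖z‖ := by linarith
  obtain ⟨hM, hM'⟩ := (bounds_of_monic (degree_monicJacobi α β n).1
    fun z => norm_le_one_of_aeval_monicJacobi hw).1 z hz1
  rw [natDegree_monicJacobi] at hM hM'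
  have hSn : S ≤ l / 4 * n := by
    have : 4 * S / l ≤ n := hN.trans (by exact_mod_cast hn)
    rw [div_le_iff₀ hl] at this
    linarith
  have hb' := hb z (by linarith)
  have hbw' := hbw z hz1.le
  have hd : 1 ≤ ‖z‖ ^ D.b.natDegree := one_le_pow₀ hz1.le
  set m := ‖aeval z (monicJacobi α β n)‖
  set t := ‖z‖ ^ D.b.natDegree
  have hm : 0 ≤ m := norm_nonneg _
  have h1 : l * t * (n / 2 * m) ≤
      ‖aeval z D.b‖ * (‖z‖ * ‖aeval z (derivative (monicJacobi α β n))‖) := by gcongr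
  have h2 : ‖z‖ * ‖aeval z D.bw‖ * m ≤ S * t * m := by gcongr
  have h3 : S * t * m ≤ l / 4 * n * t * m := by gcongr
  have h4 : ‖aeval z D.b‖ * ‖aeval z (derivative (monicJacobi α β n))‖ - ‖aeval z D.bw‖ * m ≤
      ‖aeval z (opA D.b D.bw (monicJacobi α β n))‖ := by
    simp only [opA, map_sub, map_mul]
    rw [← norm_mul, ← norm_mul]
    exact norm_sub_norm_le _ _
  have h5 : l / 4 * n * (‖z‖ - 1) ^ n ≤ l / 4 * n * (t * m) := by
    gcongr
    nlinarith
  have h6 := mul_le_mul_of_nonneg_left h4 (zero_le_one.trans hz1.le)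
  linarith

lemma exists_normW_opA_le (hw : IntegrableOn (jacobiWeight α β) (Ioo (-1) 1)) :
    ∃ K > 0, ∀ n ≥ 1, D.normW (opA D.b D.bw (monicJacobi α β n)) ≤ K * n * 2 ^ n := by
  have hcont : ∀ p : ℝ[X], ∃ K : ℝ, 0 < K ∧ ∀ x : ℝ, |x| ≤ 1 → |p.eval x| ≤ K := fun p => by
    obtain ⟨K, hK⟩ := (isCompact_Icc (a := (-1 : ℝ)) (b := 1)).exists_bound_of_continuousOn
      p.continuous.continuousOn
    exact ⟨max K 1, by positivity, fun x hx => (hK x (abs_le.1 hx)).trans (le_max_left _ _)⟩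
  obtain ⟨K₁, hK₁, h₁⟩ := hcont D.b
  obtain ⟨K₂, hK₂, h₂⟩ := hcont D.bw
  refine ⟨K₁ + K₂, by positivity, fun n hn => D.normW_le (by positivity) fun x hx => ?_⟩
  obtain ⟨hM, hM'⟩ := (bounds_of_monic (degree_monicJacobi α β n).1
    fun z => norm_le_one_of_aeval_monicJacobi hw).2 x hx
  rw [natDegree_monicJacobi] at hM hM'
  have hn' : (1 : ℝ) ≤ n := by exact_mod_cast hn
  simp only [opA, eval_sub, eval_mul]
  calc _ ≤ |D.b.eval x * (derivative (monicJacobi α β n)).eval x| +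
        |D.bw.eval x * (monicJacobi α β n).eval x| := abs_sub _ _
    _ ≤ K₁ * (n * 2 ^ n) + K₂ * (1 * 2 ^ n) := by
      rw [abs_mul, abs_mul, one_mul]
      gcongr
      exacts [h₁ x hx, h₂ x hx]
    _ ≤ K₁ * (n * 2 ^ n) + K₂ * (n * 2 ^ n) := by gcongr
    _ = _ := by ring

/-- Exceptional Jacobi polynomials of large degree double norms outside a fixed disc. -/
lemma exists_two_mul_norm_le_excMap (hw : IntegrableOn (jacobiWeight α β) (Ioo (-1) 1)) :
    ∃ R : ℝ, 1 < R ∧ ∃ N : ℕ, ∀ n, N < n → ∀ z : ℂ, R ≤ ‖z‖ → 2 * ‖z‖ ≤ ‖D.excMap n z‖ := by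
  obtain ⟨c, hc, R, hR, N, hlow⟩ := D.exists_le_norm_aeval_opA hw
  obtain ⟨K, hK, hup⟩ := D.exists_normW_opA_le hw
  -- For `9 ≤ ‖z‖` the base `(‖z‖ - 1) / 2` is at least `4` and at least `‖z‖ / 4`. Two of the `n`
  -- factors absorb `2 * ‖z‖ ^ 2 = 32 * (‖z‖ / 4) ^ 2`; the other `n - 2` give a power of `4` that
  -- beats `32 * K / c`.
  obtain ⟨N', hN'⟩ := pow_unbounded_of_one_lt (32 * K / c) (by norm_num : (1 : ℝ) < 4)
  refine ⟨max R 9, hR.trans_le (le_max_left _ _), max N (N' + 2), fun n hn z hz => ?_⟩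
  have hz1 : R ≤ ‖z‖ := (le_max_left _ _).trans hz
  have hz2 : 9 ≤ ‖z‖ := (le_max_right _ _).trans hz
  obtain ⟨m, rfl⟩ : ∃ m, n = m + 2 := ⟨n - 2, by omega⟩
  have hmN : N' ≤ m := by omega
  have hlow' := hlow (m + 2) (by omega) z hz1
  have hup' := hup (m + 2) (by omega)
  rw [D.norm_excMap hw]
  set f := opA D.b D.bw (monicJacobi α β (m + 2))
  have hnpos : (0 : ℝ) < (m + 2 : ℕ) := by positivity
  have hzpos : 0 < ‖z‖ := by linarith
  have hf : f ≠ 0 := by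
    intro h0
    rw [h0, map_zero, norm_zero, mul_zero] at hlow'
    have : 0 < c * (m + 2 : ℕ) * (‖z‖ - 1) ^ (m + 2) :=
      mul_pos (mul_pos hc hnpos) (pow_pos (by linarith) _)
    linarith
  rw [le_div_iff₀ (D.normW_pos hf)]
  have h4 : 32 * K ≤ c * 4 ^ m := by
    have := hN'.le.trans (pow_le_pow_right₀ (by norm_num : (1 : ℝ) ≤ 4) hmN)
    rw [div_le_iff₀ hc] at this
    linarith
  have hpow : 2 ^ (m + 2) * (4 ^ m * (‖z‖ / 4) ^ 2) ≤ (‖z‖ - 1) ^ (m + 2) := by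
    calc (2 : ℝ) ^ (m + 2) * (4 ^ m * (‖z‖ / 4) ^ 2)
        ≤ 2 ^ (m + 2) * (((‖z‖ - 1) / 2) ^ m * ((‖z‖ - 1) / 2) ^ 2) := by
          have h1 : (4 : ℝ) ≤ (‖z‖ - 1) / 2 := by linarith
          have h2 : ‖z‖ / 4 ≤ (‖z‖ - 1) / 2 := by linarith
          gcongr
      _ = (‖z‖ - 1) ^ (m + 2) := by rw [← pow_add, ← mul_pow]; congr 1; ring
  refine le_of_mul_le_mul_left ?_ hzpos
  calc ‖z‖ * (2 * ‖z‖ * D.normW f)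
      ≤ ‖z‖ * (2 * ‖z‖ * (K * (m + 2 : ℕ) * 2 ^ (m + 2))) := by gcongr
    _ = 32 * K * ((m + 2 : ℕ) * 2 ^ (m + 2) * (‖z‖ / 4) ^ 2) := by ring
    _ ≤ c * 4 ^ m * ((m + 2 : ℕ) * 2 ^ (m + 2) * (‖z‖ / 4) ^ 2) := by gcongr
    _ = c * (m + 2 : ℕ) * (2 ^ (m + 2) * (4 ^ m * (‖z‖ / 4) ^ 2)) := by ring
    _ ≤ c * (m + 2 : ℕ) * (‖z‖ - 1) ^ (m + 2) := by gcongr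
    _ ≤ _ := hlow'

end DarbouxTransform

end ExceptionalJacobi

theorem corollary2 (α β : ℝ) (hα : -(1 / 2) ≤ α) (hβ : -(1 / 2) ≤ β)
    (D : ExceptionalJacobi.DarbouxTransform α β) :
    (∃ R : ℝ, 1 < R ∧ ∃ N : ℕ, ∀ n : ℕ, N < n →
      ExceptionalJacobi.filledJulia (D.excMap n) ⊆ D.excMap n ⁻¹' Metric.closedBall 0 R ∧
      D.excMap n ⁻¹' Metric.closedBall 0 R ⊆ Metric.ball 0 R) ∧
    (∃ R' : ℝ, ∀ n : ℕ, 2 ≤ (D.excPoly n).natDegree →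
      ExceptionalJacobi.filledJulia (D.excMap n) ⊆ Metric.ball 0 R') := by
  obtain ⟨R, hR, N, h⟩ := D.exists_two_mul_norm_le_excMap
    (ExceptionalJacobi.integrableOn_jacobiWeight (by linarith) (by linarith))
  have ha := fun n hn => ExceptionalJacobi.filledJulia_subset (zero_lt_one.trans hR) (h n hn)
  refine ⟨⟨R, hR, N, ha⟩, ?_⟩
  have hsmall : ∀ n : ℕ, ∃ r : ℝ, 2 ≤ (D.excPoly n).natDegree →
      ExceptionalJacobi.filledJulia (D.excMap n) ⊆ Metric.ball 0 r := by
    intro n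
    by_cases hn : 2 ≤ (D.excPoly n).natDegree
    · obtain ⟨r, hr, hz⟩ := ExceptionalJacobi.exists_two_mul_norm_le hn
      have := ExceptionalJacobi.filledJulia_subset (f := D.excMap n) hr hz
      exact ⟨r, fun _ => this.1.trans this.2⟩
    -- The radius is arbitrary where the degree is below `2`.
    · exact ⟨0, fun h => absurd h hn⟩
  choose r hr using hsmall
  obtain ⟨M, hM⟩ := ((Finset.range (N + 1)).image r).bddAbove
  refine ⟨max R M, fun n hn => ?_⟩
  rcases lt_or_ge N n with h' | h'
  · exact ((ha n h').1.trans (ha n h').2).trans (Metric.ball_subset_ball (le_max_left _ _))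
  · refine (hr n hn).trans (Metric.ball_subset_ball (le_trans (hM ?_) (le_max_right _ _)))
    exact Finset.mem_coe.2 (Finset.mem_image_of_mem r (Finset.mem_range.2 (by omega)))
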